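/- Let $3\le r\le\infty$, let $U\subseteq\mathbb R^4$ be open with coordinates $q=(x,v,D,c)$, and consider one-parameter families (parameter $c$) of integrable two-degree-of-freedom Hamiltonians $H_0(x,v,D;c)$ of class $C^r$ on $U$, where $\theta$, the angle conjugate to $D$, does not enter. Equip the space $C^r(U)$ of such families with the topology of uniform convergence on compact subsets of $U$ of all derivatives of order at most $r$. Put $$F=\{q\in U:\nabla_{x,v}H_0(q)=0\},\quad P=\Big\{q\in F:\det\tfrac{\partial^2H_0}{\partial(x,v)^2}(q)=0\Big\},\quad T=\Big\{q\in U:\tfrac{\partial H_0}{\partial D}(q)=0\Big\}.$$ Points of $P$ are parabolic invariant circles, and points of $P\cap T$ are the parabolic circles of fixed points. Call $q\in P\cap T$ *transverse* if it lies on a two-dimensional $C^1$ branch of $F$ on which the differentials at $q$ of $\det\frac{\partial^2H_0}{\partial(x,v)^2}$ and of $\frac{\partial H_0}{\partial D}$ are linearly independent. The condition $$\Big\|\nabla_{x,v}\frac{\partial H_0}{\partial c}\Big\|+\Big\|\nabla_{x,v}\frac{\partial H_0}{\partial D}\Big\|\neq0\qquad(*)$$ is necessary for the generic existence of parabolic circles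 of fixed points, in the following senses: 1. If $q$ is a transverse parabolic circle of fixed points, then $(*)$ holds at points of $U$ arbitrarily close to $q$ (possibly $q$ itself). 2. If $q$ is a parabolic circle of fixed points at which $F$ is cut out transversely (the differentials of $\partial H_0/\partial x$ and $\partial H_0/\partial v$ are linearly independent at $q$), then $(*)$ holds at $q$. 3. If $V\subseteq U$ is open and every family sufficiently close to $H_0$ in $C^r(U)$ has a parabolic circle of fixed points in $V$, then $(*)$ holds at some point of $V$. Every separable family $H_0=h(x,v)+g(D;c)$ satisfies $\nabla_{x,v}\frac{\partial H_0}{\partial c}\equiv0$ and $\nabla_{x,v}\frac{\partial H_0}{\partial D}\equiv0$ on $U$. If both of these gradients vanish identically on $U$, then $F$ is parallel to the $(D,c)$-plane: for fixed $(x,v)$ and any connected set $C$ with $\{(x,v)\}\times C\subseteq U$, either all or none of the points of $\{(x,v)\}\times C$ belong to $F$. Moreover parabolic circles are then non-generic: in the class of families for which both gradients vanish identically on $U$, and likewise in the class of families that are separable as above, those with $P=\emptyset$ (in particular, without parabolic circles of fixed points) form a dense $G_\delta$ set. -/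

import Mathlib

open Set Filter Topology
open scoped UniformConvergence

noncomputable section

namespace ParabolicResonance

/-- Points `q = ((x, v), (D, c))`: the `(x, v)`-plane, the conserved action `D`, the parameter `c`. -/
abbrev Pt : Type := (ℝ × ℝ) × (ℝ × ℝ)

/-- Derivative of `f` at `q` in the direction `e`. -/
def pd (e : Pt) (f : Pt → ℝ) (q : Pt) : ℝ := fderiv ℝ f q e

/-- `∂f/∂x` -/
def dX (f : Pt → ℝ) : Pt → ℝ := pd ((1, 0), (0, 0)) f
/-- `∂f/∂v` -/
def dV (f : Pt → ℝ) : Pt → ℝ := pd ((0, 1), (0, 0)) f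
/-- `∂f/∂D` -/
def dD (f : Pt → ℝ) : Pt → ℝ := pd ((0, 0), (1, 0)) f
/-- `∂f/∂c` -/
def dC (f : Pt → ℝ) : Pt → ℝ := pd ((0, 0), (0, 1)) f

/-- The gradient `∇_{x,v} f`, with the Euclidean norm. -/
def gradXV (f : Pt → ℝ) (q : Pt) : EuclideanSpace ℝ (Fin 2) := !₂[dX f q, dV f q]

/-- The Hessian matrix of `H` in the variables `(x, v)`. -/
def hessXV (H : Pt → ℝ) (q : Pt) : Matrix (Fin 2) (Fin 2) ℝ :=
  !![dX (dX H) q, dV (dX H) q; dX (dV H) q, dV (dV H) q]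

/-- The determinant whose vanishing characterizes parabolic fixed points. -/
def hessDet (H : Pt → ℝ) (q : Pt) : ℝ := (hessXV H q).det

/-- The surface `F` of fixed points of the reduced flow in the `(x, v)`-plane. -/
def fixedSurface (U : Set Pt) (H : Pt → ℝ) : Set Pt := {q | q ∈ U ∧ gradXV H q = 0}

/-- The set `P ⊆ F` of parabolic fixed points (parabolic invariant circles of the full flow). -/
def parabolicSet (U : Set Pt) (H : Pt → ℝ) : Set Pt :=
  {q | q ∈ fixedSurface U H ∧ hessDet H q = 0}

/-- The set `T` where the angular frequency `dθ/dt = ∂H/∂D` vanishes. -/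
def zeroFrequency (U : Set Pt) (H : Pt → ℝ) : Set Pt := {q | q ∈ U ∧ dD H q = 0}

/-- The parabolic circles of fixed points of the full flow: `P ∩ T`. -/
def parabolicCircles (U : Set Pt) (H : Pt → ℝ) : Set Pt :=
  parabolicSet U H ∩ zeroFrequency U H

/-- `F` is cut out transversely at `q`: the differentials of `∂H/∂x`, `∂H/∂v` are independent. -/
def RegularAt (H : Pt → ℝ) (q : Pt) : Prop :=
  LinearIndependent ℝ ![fderiv ℝ (dX H) q, fderiv ℝ (dV H) q]

/-- `q` is a parabolic circle of fixed points arising from a transverse intersection: it lies on a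
two-dimensional `C¹` branch `σ` of `F` on which the sets `P = {hessDet = 0}` and
`T = {∂H/∂D = 0}` are cut out transversely, as curves, and cross transversely at `q`. -/
def IsTransverseParabolicCircle (U : Set Pt) (H : Pt → ℝ) (q : Pt) : Prop :=
  q ∈ parabolicCircles U H ∧
  ∃ σ : ℝ × ℝ → Pt, ContDiffAt ℝ 1 σ 0 ∧ σ 0 = q ∧
    Function.Injective (fderiv ℝ σ 0) ∧
    (∀ᶠ s in 𝓝 (0 : ℝ × ℝ), σ s ∈ fixedSurface U H) ∧
    LinearIndependent ℝ ![fderiv ℝ (hessDet H ∘ σ) 0, fderiv ℝ (dD H ∘ σ) 0]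

/-- The non-degeneracy condition `‖∇_{x,v} ∂H/∂c‖ + ‖∇_{x,v} ∂H/∂D‖ ≠ 0` at the point `q`. -/
def Coupled (H : Pt → ℝ) (q : Pt) : Prop :=
  ‖gradXV (dC H) q‖ + ‖gradXV (dD H) q‖ ≠ 0

/-- One-parameter families `H(x, v, D; c)` of integrable two-degree-of-freedom Hamiltonians of
class `C^r` on `U`; values off `U` are irrelevant. -/
structure Family (r : ℕ∞) (U : Set Pt) where
  /-- the Hamiltonian `H(x, v, D; c)` -/
  ham : Pt → ℝ
  contDiffOn : ContDiffOn ℝ r ham U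

/-- The `C^r` topology: uniform convergence on compact subsets of `U` of all derivatives of
order at most `r`. -/
instance (r : ℕ∞) (U : Set Pt) : TopologicalSpace (Family r U) :=
  TopologicalSpace.induced
    (fun H (k : {k : ℕ // (k : ℕ∞) ≤ r}) =>
      UniformOnFun.ofFun {K : Set Pt | IsCompact K ∧ K ⊆ U} (iteratedFDeriv ℝ k.1 H.ham))
    inferInstance

/-- The families for which both mixed gradients vanish identically on `U`. -/
def uncoupled (r : ℕ∞) (U : Set Pt) : Set (Family r U) :=
  {H | ∀ q ∈ U, gradXV (dC H.ham) q = 0 ∧ gradXV (dD H.ham) q = 0}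

/-- The separable families in which the parameter enters only the `D`-part:
`H = h(x, v) + g(D; c)` on `U`. -/
def separable (r : ℕ∞) (U : Set Pt) : Set (Family r U) :=
  {H | ∃ h g : ℝ × ℝ → ℝ, ∀ q ∈ U, H.ham q = h q.1 + g q.2}

/-- In the class `𝒞`, with its `C^r` topology, parabolic points are non-generic: the families
without any of them form a dense `G_δ` set. -/
def ParabolicNongeneric {r : ℕ∞} {U : Set Pt} (𝒞 : Set (Family r U)) : Prop :=
  IsGδ {H : 𝒞 | parabolicSet U H.1.ham = ∅} ∧ Dense {H : 𝒞 | parabolicSet U H.1.ham = ∅}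

end ParabolicResonance

end

open ParabolicResonance

namespace ParabolicResonance

/-! If both mixed gradients vanish on an open set, the `(x, v)`-gradient of `H` has zero derivative
in the `D` and `c` directions. Locally it is then a map `G` of the plane, whose Jacobian is the `(x,
v)`-Hessian.

Where this Jacobian is invertible, tangent vectors to a branch of the fixed surface are vertical,
and `hessDet` has no vertical derivative; so `hessDet` cannot have nonzero differential along a
branch (`mem_closure_coupled`). At a single uncoupled parabolic point, the differentials of the two
gradient components are given by the rows of a singular matrix (`coupled_of_regularAt`).

Subtracting `a x + b v` keeps the Hessian, and parabolic points of the new family are critical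
points of `G` with value `(a, b)`. By Sard (`UncoupledOn.volume_critical_values`) almost every `(a,
b)` leaves none: this excludes persistence and gives density. The `G_δ` property comes from a
compact exhaustion of `U`. -/

lemma gradXV_eq_zero_iff (f : Pt → ℝ) (q : Pt) : gradXV f q = 0 ↔ dX f q = 0 ∧ dV f q = 0 := by
  constructor
  · intro h
    exact ⟨by simpa [gradXV] using congrArg (fun u => u 0) h,
      by simpa [gradXV] using congrArg (fun u => u 1) h⟩
  · rintro ⟨h1, h2⟩
    ext i
    fin_cases i <;> simp [gradXV, h1, h2]

lemma not_coupled_iff (H : Pt → ℝ) (q : Pt) :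
    ¬ Coupled H q ↔ gradXV (dC H) q = 0 ∧ gradXV (dD H) q = 0 := by
  rw [Coupled, not_not, add_eq_zero_iff_of_nonneg (norm_nonneg _) (norm_nonneg _), norm_eq_zero,
    norm_eq_zero]

lemma hessDet_eq (H : Pt → ℝ) (q : Pt) :
    hessDet H q = dX (dX H) q * dV (dV H) q - dV (dX H) q * dX (dV H) q := by
  simp [hessDet, hessXV, Matrix.det_fin_two_of]

lemma pd_contDiffOn {n m : WithTop ℕ∞} {U : Set Pt} {f : Pt → ℝ} (hU : IsOpen U)
    (hf : ContDiffOn ℝ n f U) (hmn : m + 1 ≤ n) (e : Pt) : ContDiffOn ℝ m (pd e f) U :=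
  (hf.fderiv_of_isOpen hU hmn).clm_apply contDiffOn_const

lemma pd_congr {U : Set Pt} (hU : IsOpen U) {f g : Pt → ℝ} (h : EqOn f g U) (e : Pt) :
    EqOn (pd e f) (pd e g) U := fun q hq => by
  have : f =ᶠ[𝓝 q] g := h.eventuallyEq_of_mem (hU.mem_nhds hq)
  simp only [pd, this.fderiv_eq]

lemma pd_pd_eq {U : Set Pt} (hU : IsOpen U) {f : Pt → ℝ} (hf : ContDiffOn ℝ 2 f U) (e e' : Pt)
    {q : Pt} (hq : q ∈ U) : pd e (pd e' f) q = fderiv ℝ (fderiv ℝ f) q e e' := by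
  have h : DifferentiableAt ℝ (fderiv ℝ f) q :=
    ((hf.fderiv_of_isOpen hU (m := 1) (by norm_num)).contDiffAt (hU.mem_nhds hq)).differentiableAt
      (by norm_num)
  have : HasFDerivAt (pd e' f) ((fderiv ℝ (fderiv ℝ f) q).flip e') q := by
    refine (h.hasFDerivAt.clm_apply (hasFDerivAt_const e' q)).congr_fderiv ?_
    refine ContinuousLinearMap.ext fun u => ?_
    simp
  rw [pd, this.fderiv]
  rfl

lemma pd_comm {U : Set Pt} (hU : IsOpen U) {f : Pt → ℝ} (hf : ContDiffOn ℝ 2 f U) (e e' : Pt)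
    {q : Pt} (hq : q ∈ U) : pd e (pd e' f) q = pd e' (pd e f) q := by
  rw [pd_pd_eq hU hf e e' hq, pd_pd_eq hU hf e' e hq]
  exact ((hf.contDiffAt (hU.mem_nhds hq)).isSymmSndFDerivAt (by simp)).eq e e'

lemma fderiv_apply_eq (f : Pt → ℝ) (q : Pt) (a b c d : ℝ) :
    fderiv ℝ f q ((a, b), (c, d)) = a * dX f q + b * dV f q + c * dD f q + d * dC f q := by
  have : (((a, b), (c, d)) : Pt) = a • ((1, 0), (0, 0)) + b • ((0, 1), (0, 0)) +
      c • ((0, 0), (1, 0)) + d • ((0, 0), (0, 1)) := by simp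
  rw [this]
  simp only [map_add, map_smul, smul_eq_mul]
  rfl

/-! ### Vertical derivatives of the gradient and the Hessian -/

/-- Both mixed gradients of `H` vanish at every point of `V`. -/
def UncoupledOn (V : Set Pt) (H : Pt → ℝ) : Prop :=
  ∀ q ∈ V, gradXV (dC H) q = 0 ∧ gradXV (dD H) q = 0

namespace UncoupledOn

variable {V : Set Pt} {H : Pt → ℝ}

lemma dD_dX (h : UncoupledOn V H) (hV : IsOpen V) (hf : ContDiffOn ℝ 2 H V) {q : Pt}
    (hq : q ∈ V) : dD (dX H) q = 0 :=
  (pd_comm hV hf _ _ hq).trans ((gradXV_eq_zero_iff _ _).1 (h q hq).2).1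

lemma dC_dX (h : UncoupledOn V H) (hV : IsOpen V) (hf : ContDiffOn ℝ 2 H V) {q : Pt}
    (hq : q ∈ V) : dC (dX H) q = 0 :=
  (pd_comm hV hf _ _ hq).trans ((gradXV_eq_zero_iff _ _).1 (h q hq).1).1

lemma dD_dV (h : UncoupledOn V H) (hV : IsOpen V) (hf : ContDiffOn ℝ 2 H V) {q : Pt}
    (hq : q ∈ V) : dD (dV H) q = 0 :=
  (pd_comm hV hf _ _ hq).trans ((gradXV_eq_zero_iff _ _).1 (h q hq).2).2

lemma dC_dV (h : UncoupledOn V H) (hV : IsOpen V) (hf : ContDiffOn ℝ 2 H V) {q : Pt}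
    (hq : q ∈ V) : dC (dV H) q = 0 :=
  (pd_comm hV hf _ _ hq).trans ((gradXV_eq_zero_iff _ _).1 (h q hq).1).2

lemma fderiv_dX (h : UncoupledOn V H) (hV : IsOpen V) (hf : ContDiffOn ℝ 2 H V) {q : Pt}
    (hq : q ∈ V) (u : Pt) :
    fderiv ℝ (dX H) q u = u.1.1 * dX (dX H) q + u.1.2 * dV (dX H) q := by
  obtain ⟨⟨a, b⟩, c, d⟩ := u
  rw [fderiv_apply_eq, h.dD_dX hV hf hq, h.dC_dX hV hf hq]
  simp

lemma fderiv_dV (h : UncoupledOn V H) (hV : IsOpen V) (hf : ContDiffOn ℝ 2 H V) {q : Pt}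
    (hq : q ∈ V) (u : Pt) :
    fderiv ℝ (dV H) q u = u.1.1 * dX (dV H) q + u.1.2 * dV (dV H) q := by
  obtain ⟨⟨a, b⟩, c, d⟩ := u
  rw [fderiv_apply_eq, h.dD_dV hV hf hq, h.dC_dV hV hf hq]
  simp

end UncoupledOn

lemma pd_pd_vertical_eq_zero {V : Set Pt} (hV : IsOpen V) {f : Pt → ℝ}
    (hf : ContDiffOn ℝ 2 f V) (e e' : Pt) (h : ∀ q ∈ V, pd e f q = 0) {q : Pt} (hq : q ∈ V) :
    pd e (pd e' f) q = 0 := by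
  rw [pd_comm hV hf e e' hq, pd_congr hV (g := fun _ => (0 : ℝ)) (fun p hp => h p hp) e' hq]
  simp [pd]

lemma hessDet_contDiffOn {U : Set Pt} (hU : IsOpen U) {H : Pt → ℝ} (hf : ContDiffOn ℝ 3 H U) :
    ContDiffOn ℝ 1 (hessDet H) U := by
  have h2 : ∀ e e', ContDiffOn ℝ 1 (pd e (pd e' H)) U := fun e e' =>
    pd_contDiffOn hU (pd_contDiffOn hU hf (m := 2) (by norm_num) e') (by norm_num) e
  rw [show hessDet H = fun q => dX (dX H) q * dV (dV H) q - dV (dX H) q * dX (dV H) q from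
    funext (hessDet_eq H)]
  exact ((h2 _ _).mul (h2 _ _)).sub ((h2 _ _).mul (h2 _ _))

/-- The Hessian entries are derivatives of `dX H` and `dV H`, whose vertical derivatives vanish;
third-order smoothness lets the derivatives commute. -/
lemma UncoupledOn.fderiv_hessDet_vertical {V : Set Pt} {H : Pt → ℝ} (h : UncoupledOn V H)
    (hV : IsOpen V) (hf : ContDiffOn ℝ 3 H V) {q : Pt} (hq : q ∈ V) (u : Pt) (hu : u.1 = 0) :
    fderiv ℝ (hessDet H) q u = 0 := by
  have hf2 : ContDiffOn ℝ 2 H V := hf.of_le (by norm_num)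
  have h2 : ∀ e e', DifferentiableAt ℝ (pd e (pd e' H)) q := fun e e' =>
    ((pd_contDiffOn hV (pd_contDiffOn hV hf (m := 2) (by norm_num) e') (m := 1) (by norm_num)
      e).contDiffAt (hV.mem_nhds hq)).differentiableAt (by norm_num)
  have hX : ∀ e, fderiv ℝ (pd e (dX H)) q u = 0 := fun e =>
    pd_pd_vertical_eq_zero hV (pd_contDiffOn hV hf (by norm_num) _) u e
      (fun p hp => (h.fderiv_dX hV hf2 hp u).trans (by simp [hu])) hq
  have hVv : ∀ e, fderiv ℝ (pd e (dV H)) q u = 0 := fun e =>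
    pd_pd_vertical_eq_zero hV (pd_contDiffOn hV hf (by norm_num) _) u e
      (fun p hp => (h.fderiv_dV hV hf2 hp u).trans (by simp [hu])) hq
  rw [show hessDet H = fun q => dX (dX H) q * dV (dV H) q - dV (dX H) q * dX (dV H) q from
    funext (hessDet_eq H)]
  have d1 : DifferentiableAt ℝ (dX (dX H)) q := h2 _ _
  have d2 : DifferentiableAt ℝ (dV (dV H)) q := h2 _ _
  have d3 : DifferentiableAt ℝ (dV (dX H)) q := h2 _ _
  have d4 : DifferentiableAt ℝ (dX (dV H)) q := h2 _ _
  rw [fderiv_fun_sub (d1.fun_mul d2) (d3.fun_mul d4), fderiv_fun_mul d1 d2, fderiv_fun_mul d3 d4]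
  have e1 : fderiv ℝ (dX (dX H)) q u = 0 := hX _
  have e2 : fderiv ℝ (dV (dV H)) q u = 0 := hVv _
  have e3 : fderiv ℝ (dV (dX H)) q u = 0 := hX _
  have e4 : fderiv ℝ (dX (dV H)) q u = 0 := hVv _
  simp [e1, e2, e3, e4]

/-! ### Necessity at regular and at transverse points -/

lemma coupled_of_regularAt {U : Set Pt} (hU : IsOpen U) {H : Pt → ℝ} (hf : ContDiffOn ℝ 2 H U)
    {q : Pt} (hq : q ∈ parabolicSet U H) (hreg : RegularAt H q) : Coupled H q := by
  by_contra hc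
  obtain ⟨hc, hd⟩ := (not_coupled_iff H q).1 hc
  rw [gradXV_eq_zero_iff] at hc hd
  have hqU := hq.1.1
  have hdet := hq.2
  rw [hessDet_eq] at hdet
  have hX : ∀ u : Pt, fderiv ℝ (dX H) q u = u.1.1 * dX (dX H) q + u.1.2 * dV (dX H) q := by
    rintro ⟨⟨a, b⟩, c, d⟩
    have h1 : dD (dX H) q = 0 := (pd_comm hU hf _ _ hqU).trans hd.1
    have h2 : dC (dX H) q = 0 := (pd_comm hU hf _ _ hqU).trans hc.1
    rw [fderiv_apply_eq, h1, h2]; simp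
  have hVv : ∀ u : Pt, fderiv ℝ (dV H) q u = u.1.1 * dX (dV H) q + u.1.2 * dV (dV H) q := by
    rintro ⟨⟨a, b⟩, c, d⟩
    have h1 : dD (dV H) q = 0 := (pd_comm hU hf _ _ hqU).trans hd.2
    have h2 : dC (dV H) q = 0 := (pd_comm hU hf _ _ hqU).trans hc.2
    rw [fderiv_apply_eq, h1, h2]; simp
  rw [RegularAt, LinearIndependent.pair_iff] at hreg
  -- The rows of the adjugate give two linear relations; independence then kills every Hessian
  -- entry, so the first differential is zero.
  have k1 := hreg (dV (dV H) q) (-dV (dX H) q) (by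
    refine ContinuousLinearMap.ext fun u => ?_
    simp only [add_apply, smul_apply, hX, hVv,
      smul_eq_mul, zero_apply]
    linear_combination u.1.1 * hdet)
  have k2 := hreg (-dX (dV H) q) (dX (dX H) q) (by
    refine ContinuousLinearMap.ext fun u => ?_
    simp only [add_apply, smul_apply, hX, hVv,
      smul_eq_mul, zero_apply]
    linear_combination u.1.2 * hdet)
  have k3 := hreg 1 0 (by
    refine ContinuousLinearMap.ext fun u => ?_
    simp only [add_apply, smul_apply, hX, hVv,
      smul_eq_mul, zero_apply, k2.2, neg_eq_zero.1 k1.2]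
    ring)
  exact one_ne_zero k3.1

lemma mem_closure_coupled {U : Set Pt} (hU : IsOpen U) {H : Pt → ℝ} (hf : ContDiffOn ℝ 3 H U)
    {q : Pt} (hq : IsTransverseParabolicCircle U H q) :
    q ∈ closure {p | p ∈ U ∧ Coupled H p} := by
  by_contra hcl
  obtain ⟨hqP, σ, hσ, hσ0, -, hF, hind⟩ := hq
  set N : Set Pt := U ∩ (closure {p | p ∈ U ∧ Coupled H p})ᶜ with hN
  have hNo : IsOpen N := hU.inter isClosed_closure.isOpen_compl
  have hqN : σ 0 ∈ N := hσ0 ▸ ⟨hqP.1.1.1, hcl⟩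
  have hunc : UncoupledOn N H := fun p hp => (not_coupled_iff H p).1 fun hc =>
    hp.2 (subset_closure ⟨hp.1, hc⟩)
  have hf3 : ContDiffOn ℝ 3 H N := hf.mono inter_subset_left
  have hf2 : ContDiffOn ℝ 2 H N := hf3.of_le (by norm_num)
  have hdet := hessDet_contDiffOn hNo hf3
  have hne : fderiv ℝ (hessDet H ∘ σ) 0 ≠ 0 := by simpa using hind.ne_zero 0
  have hδ : ContDiffAt ℝ 1 (hessDet H ∘ σ) 0 :=
    (hdet.contDiffAt (hNo.mem_nhds hqN)).comp 0 hσ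
  have hcont : ∀ᶠ s in 𝓝 (0 : ℝ × ℝ), fderiv ℝ (hessDet H ∘ σ) s ≠ 0 :=
    (hδ.fderiv_right (m := 0) (by norm_num)).continuousAt.eventually_ne hne
  have hσd : ∀ᶠ s in 𝓝 (0 : ℝ × ℝ), DifferentiableAt ℝ σ s :=
    (hσ.eventually (by norm_num)).mono fun s hs => hs.differentiableAt (by norm_num)
  have hσN : ∀ᶠ s in 𝓝 (0 : ℝ × ℝ), σ s ∈ N := hσ.continuousAt (hNo.mem_nhds hqN)
  -- If the Hessian were invertible at a nearby `s`, the branch would be vertical there and the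
  -- differential of `hessDet ∘ σ` would vanish, contrary to `hcont`.
  have hzero : hessDet H ∘ σ =ᶠ[𝓝 0] fun _ => (0 : ℝ) := by
    filter_upwards [hcont, hσd, hσN, hF.eventually_nhds] with s hs hd hsN hsF
    by_contra hdet0
    apply hs
    have diff : ∀ {f : Pt → ℝ}, ContDiffOn ℝ 1 f N → DifferentiableAt ℝ f (σ s) := fun h =>
      (h.contDiffAt (hNo.mem_nhds hsN)).differentiableAt (by norm_num)
    have hX : fderiv ℝ (dX H ∘ σ) s = 0 := by
      have : dX H ∘ σ =ᶠ[𝓝 s] fun _ => (0 : ℝ) := hsF.mono fun t ht =>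
        ((gradXV_eq_zero_iff _ _).1 ht.2).1
      rw [this.fderiv_eq]; simp
    have hVv : fderiv ℝ (dV H ∘ σ) s = 0 := by
      have : dV H ∘ σ =ᶠ[𝓝 s] fun _ => (0 : ℝ) := hsF.mono fun t ht =>
        ((gradXV_eq_zero_iff _ _).1 ht.2).2
      rw [this.fderiv_eq]; simp
    have dX' : DifferentiableAt ℝ (dX H) (σ s) := diff (pd_contDiffOn hNo hf2 (by norm_num) _)
    have dV' : DifferentiableAt ℝ (dV H) (σ s) := diff (pd_contDiffOn hNo hf2 (by norm_num) _)
    rw [fderiv_comp s dX' hd] at hX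
    rw [fderiv_comp s dV' hd] at hVv
    rw [fderiv_comp s (diff hdet) hd]
    refine ContinuousLinearMap.ext fun t => ?_
    have hXt := DFunLike.congr_fun hX t
    have hVt := DFunLike.congr_fun hVv t
    simp only [ContinuousLinearMap.comp_apply, zero_apply] at hXt hVt ⊢
    rw [hunc.fderiv_dX hNo hf2 hsN] at hXt
    rw [hunc.fderiv_dV hNo hf2 hsN] at hVt
    -- Cramer's rule: the Hessian annihilates the horizontal part of the tangent vector.
    refine hunc.fderiv_hessDet_vertical hNo hf3 hsN _ (Prod.ext ?_ ?_)
    · refine (mul_eq_zero.1 ?_).resolve_left hdet0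
      rw [Function.comp_apply, hessDet_eq]
      linear_combination dV (dV H) (σ s) * hXt - dV (dX H) (σ s) * hVt
    · refine (mul_eq_zero.1 ?_).resolve_left hdet0
      rw [Function.comp_apply, hessDet_eq]
      linear_combination dX (dX H) (σ s) * hVt - dX (dV H) (σ s) * hXt
  exact hne (by rw [hzero.fderiv_eq]; simp)

/-! ### Separable families -/

/-- No regularity of `h` or `g` is assumed, so the comparison uses derivatives along lines, where
`h` is a constant summand. -/
lemma pd_vertical_eq_of_separable {U : Set Pt} (hU : IsOpen U) {H : Pt → ℝ}
    (hd : ∀ q ∈ U, DifferentiableAt ℝ H q) {h g : ℝ × ℝ → ℝ}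
    (hs : ∀ q ∈ U, H q = h q.1 + g q.2) (e : ℝ × ℝ) {z z' w : ℝ × ℝ} (hz : (z, w) ∈ U)
    (hz' : (z', w) ∈ U) : pd (0, e) H (z, w) = pd (0, e) H (z', w) := by
  have key : ∀ y, (y, w) ∈ U →
      (fun t : ℝ => H ((y, w) + t • (0, e))) =ᶠ[𝓝 0] fun t => h y + g (w + t • e) := by
    intro y hy
    have : Tendsto (fun t : ℝ => ((y, w) + t • (0, e) : Pt)) (𝓝 0) (𝓝 (y, w)) := by
      have : Continuous (fun t : ℝ => ((y, w) + t • (0, e) : Pt)) := by fun_prop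
      simpa using this.tendsto 0
    filter_upwards [this (hU.mem_nhds hy)] with t ht
    simpa using hs _ ht
  have eq : ∀ y, (y, w) ∈ U → pd (0, e) H (y, w) = deriv (fun t : ℝ => g (w + t • e)) 0 := by
    intro y hy
    rw [pd, ← (hd _ hy).lineDeriv_eq_fderiv, lineDeriv, (key y hy).deriv_eq, deriv_const_add]
  rw [eq z hz, eq z' hz']

lemma pd_horizontal_pd_vertical_eq_zero_of_separable {U : Set Pt} (hU : IsOpen U) {H : Pt → ℝ}
    (hf : ContDiffOn ℝ 2 H U) {h g : ℝ × ℝ → ℝ} (hs : ∀ q ∈ U, H q = h q.1 + g q.2)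
    (e e' : ℝ × ℝ) {q : Pt} (hq : q ∈ U) : pd (e', 0) (pd (0, e) H) q = 0 := by
  have hd : ∀ q ∈ U, DifferentiableAt ℝ H q := fun q hq =>
    (hf.contDiffAt (hU.mem_nhds hq)).differentiableAt (by norm_num)
  have hd' : DifferentiableAt ℝ (pd (0, e) H) q :=
    ((pd_contDiffOn hU hf (m := 1) (by norm_num) _).contDiffAt
      (hU.mem_nhds hq)).differentiableAt (by norm_num)
  rw [pd, ← hd'.lineDeriv_eq_fderiv, lineDeriv]
  have : Tendsto (fun t : ℝ => (q + t • (e', 0) : Pt)) (𝓝 0) (𝓝 q) := by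
    have : Continuous (fun t : ℝ => (q + t • (e', 0) : Pt)) := by fun_prop
    simpa using this.tendsto 0
  have : (fun t : ℝ => pd (0, e) H (q + t • (e', 0))) =ᶠ[𝓝 0] fun _ => pd (0, e) H q := by
    filter_upwards [this (hU.mem_nhds hq)] with t ht
    have hqt : q + t • (e', 0) = (q.1 + t • e', q.2) := by ext <;> simp
    rw [mem_preimage, hqt] at ht
    rw [hqt]
    exact pd_vertical_eq_of_separable hU hd hs e ht hq
  rw [this.deriv_eq]
  simp

lemma uncoupledOn_of_separable {U : Set Pt} (hU : IsOpen U) {H : Pt → ℝ}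
    (hf : ContDiffOn ℝ 2 H U) {h g : ℝ × ℝ → ℝ} (hs : ∀ q ∈ U, H q = h q.1 + g q.2) :
    UncoupledOn U H := fun q hq => by
  simp only [gradXV_eq_zero_iff]
  exact ⟨⟨pd_horizontal_pd_vertical_eq_zero_of_separable hU hf hs (0, 1) (1, 0) hq,
    pd_horizontal_pd_vertical_eq_zero_of_separable hU hf hs (0, 1) (0, 1) hq⟩,
    pd_horizontal_pd_vertical_eq_zero_of_separable hU hf hs (1, 0) (1, 0) hq,
    pd_horizontal_pd_vertical_eq_zero_of_separable hU hf hs (1, 0) (0, 1) hq⟩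

/-! ### Constancy along vertical slices -/

lemma eventually_eq_of_fderiv_vertical_eq_zero {U : Set Pt} (hU : IsOpen U) {f : Pt → ℝ}
    (hf : ∀ q ∈ U, DifferentiableAt ℝ f q) (h0 : ∀ q ∈ U, ∀ e, fderiv ℝ f q (0, e) = 0)
    {z w : ℝ × ℝ} (hq : (z, w) ∈ U) : ∀ᶠ w' in 𝓝 w, f (z, w') = f (z, w) := by
  obtain ⟨ε, hε, hb⟩ := Metric.isOpen_iff.1 hU _ hq
  have hsub : ∀ w' ∈ Metric.ball w ε, (z, w') ∈ U := fun w' hw' => hb (by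
    rw [← ball_prod_same]; exact ⟨Metric.mem_ball_self hε, hw'⟩)
  have hder : ∀ w' ∈ Metric.ball w ε, HasFDerivAt (fun w' => f (z, w'))
      (0 : ℝ × ℝ →L[ℝ] ℝ) w' := fun w' hw' => by
    have := (hf _ (hsub w' hw')).hasFDerivAt.comp w' (hasFDerivAt_prodMk_right z w')
    refine this.congr_fderiv (ContinuousLinearMap.ext fun e => ?_)
    simpa using h0 _ (hsub w' hw') e
  filter_upwards [Metric.ball_mem_nhds w hε] with w' hw'
  exact Metric.isOpen_ball.is_const_of_fderiv_eq_zero (𝕜 := ℝ) (f := fun w' => f (z, w'))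
    (convex_ball w ε).isPreconnected
    (fun y hy => (hder y hy).differentiableAt.differentiableWithinAt)
    (fun y hy => (hder y hy).fderiv) hw' (Metric.mem_ball_self hε)

/-- `C` need not be open, so local constancy in the open slice of `U` is propagated along `C` by
connectedness. -/
lemma eq_of_fderiv_vertical_eq_zero {U : Set Pt} (hU : IsOpen U) {f : Pt → ℝ}
    (hf : ∀ q ∈ U, DifferentiableAt ℝ f q) (h0 : ∀ q ∈ U, ∀ e, fderiv ℝ f q (0, e) = 0)
    {z : ℝ × ℝ} {C : Set (ℝ × ℝ)} (hC : IsPreconnected C) (hCU : ∀ w ∈ C, (z, w) ∈ U)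
    {w w' : ℝ × ℝ} (hw : w ∈ C) (hw' : w' ∈ C) : f (z, w) = f (z, w') := by
  refine hC.induction₂ (fun w w' => f (z, w) = f (z, w')) (fun x hx => ?_)
    (fun x y t hx hy ht h1 h2 => h1.trans h2) (fun x y hx hy h => h.symm) hw hw'
  exact ((eventually_eq_of_fderiv_vertical_eq_zero hU hf h0 (hCU x hx)).mono
    fun y hy => hy.symm).filter_mono nhdsWithin_le_nhds

lemma UncoupledOn.gradXV_eq {U : Set Pt} (hU : IsOpen U) {H : Pt → ℝ} (h : UncoupledOn U H)
    (hf : ContDiffOn ℝ 2 H U) {z : ℝ × ℝ} {C : Set (ℝ × ℝ)} (hC : IsPreconnected C)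
    (hCU : ∀ w ∈ C, (z, w) ∈ U) {w w' : ℝ × ℝ} (hw : w ∈ C) (hw' : w' ∈ C) :
    dX H (z, w) = dX H (z, w') ∧ dV H (z, w) = dV H (z, w') := by
  have hd : ∀ e, ∀ q ∈ U, DifferentiableAt ℝ (pd e H) q := fun e q hq =>
    ((pd_contDiffOn hU hf (m := 1) (by norm_num) e).contDiffAt
      (hU.mem_nhds hq)).differentiableAt (by norm_num)
  exact ⟨eq_of_fderiv_vertical_eq_zero hU (hd _)
      (fun q hq e => (h.fderiv_dX hU hf hq (0, e)).trans (by simp)) hC hCU hw hw',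
    eq_of_fderiv_vertical_eq_zero hU (hd _)
      (fun q hq e => (h.fderiv_dV hU hf hq (0, e)).trans (by simp)) hC hCU hw hw'⟩

/-! ### Sard's theorem for the gradient map -/

lemma det_continuousLinearMap_prod (A : ℝ × ℝ →L[ℝ] ℝ × ℝ) :
    A.det = (A (1, 0)).1 * (A (0, 1)).2 - (A (0, 1)).1 * (A (1, 0)).2 := by
  rw [ContinuousLinearMap.det, ← LinearMap.det_toMatrix (Module.Basis.finTwoProd ℝ),
    Matrix.det_fin_two]
  simp [LinearMap.toMatrix_apply]

/-- Sard: the values of `∇_{x,v} H` at the points of `V` with degenerate Hessian form a null set,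
since `∇_{x,v} H` locally depends on `(x, v)` only. -/
lemma UncoupledOn.volume_critical_values {V : Set Pt} {H : Pt → ℝ} (h : UncoupledOn V H)
    (hV : IsOpen V) (hf : ContDiffOn ℝ 2 H V) :
    MeasureTheory.volume ((fun q => (dX H q, dV H q)) '' {q | q ∈ V ∧ hessDet H q = 0}) = 0 := by
  set G : Pt → ℝ × ℝ := fun q => (dX H q, dV H q)
  set S : Set Pt := {q | q ∈ V ∧ hessDet H q = 0}
  -- Pulling the outer measure back along `G` turns the claim into nullity of `S`, which may be
  -- checked locally.
  suffices hS : MeasureTheory.OuterMeasure.comap G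
      (MeasureTheory.volume : MeasureTheory.Measure (ℝ × ℝ)).toOuterMeasure S = 0 by
    simpa [MeasureTheory.OuterMeasure.comap_apply] using hS
  refine MeasureTheory.measure_null_of_locally_null S fun q hq => ?_
  obtain ⟨ε, hε, hb⟩ := Metric.isOpen_iff.1 hV q hq.1
  refine ⟨S ∩ Metric.ball q ε, inter_mem_nhdsWithin S (Metric.ball_mem_nhds q hε), ?_⟩
  rw [MeasureTheory.OuterMeasure.comap_apply, MeasureTheory.Measure.coe_toOuterMeasure]
  obtain ⟨z₀, w₀⟩ := q
  have hball : ∀ z ∈ Metric.ball z₀ ε, ∀ w ∈ Metric.ball w₀ ε, (z, w) ∈ V := fun z hz w hw =>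
    hb (by rw [← ball_prod_same]; exact ⟨hz, hw⟩)
  have hd : ∀ e, ∀ q ∈ V, DifferentiableAt ℝ (pd e H) q := fun e q hq =>
    ((pd_contDiffOn hV hf (m := 1) (by norm_num) e).contDiffAt
      (hV.mem_nhds hq)).differentiableAt (by norm_num)
  -- The derivative of the slice at `w₀` can be computed at any `w` of the ball, in particular at
  -- one where the Hessian degenerates.
  have hder : ∀ z ∈ Metric.ball z₀ ε, ∀ w ∈ Metric.ball w₀ ε, HasFDerivAt (fun z => G (z, w₀))
      (((fderiv ℝ (dX H) (z, w)).prod (fderiv ℝ (dV H) (z, w))).comp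
        (ContinuousLinearMap.inl ℝ (ℝ × ℝ) (ℝ × ℝ))) z := fun z hz w hw => by
    have hzw := hball z hz w hw
    have h1 : HasFDerivAt G ((fderiv ℝ (dX H) (z, w)).prod (fderiv ℝ (dV H) (z, w))) (z, w) :=
      (hd _ _ hzw).hasFDerivAt.prodMk (hd _ _ hzw).hasFDerivAt
    refine (h1.comp z (hasFDerivAt_prodMk_left z w)).congr_of_eventuallyEq ?_
    filter_upwards [Metric.isOpen_ball.mem_nhds hz] with y hy
    obtain ⟨e1, e2⟩ := h.gradXV_eq hV hf (z := y) (convex_ball w₀ ε).isPreconnected (hball y hy)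
      (Metric.mem_ball_self hε) hw
    exact Prod.ext e1 e2
  set Z : Set (ℝ × ℝ) :=
    {z | z ∈ Metric.ball z₀ ε ∧ ∃ w ∈ Metric.ball w₀ ε, hessDet H (z, w) = 0}
  have hsub : G '' (S ∩ Metric.ball (z₀, w₀) ε) ⊆ (fun z => G (z, w₀)) '' Z := by
    rintro _ ⟨⟨z, w⟩, ⟨hS, hzw⟩, rfl⟩
    rw [← ball_prod_same] at hzw
    refine ⟨z, ⟨hzw.1, w, hzw.2, hS.2⟩, ?_⟩
    obtain ⟨e1, e2⟩ := h.gradXV_eq hV hf (z := z) (convex_ball w₀ ε).isPreconnected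
      (hball z hzw.1) (Metric.mem_ball_self hε) hzw.2
    exact Prod.ext e1 e2
  refine MeasureTheory.measure_mono_null hsub
    (MeasureTheory.addHaar_image_eq_zero_of_det_fderivWithin_eq_zero MeasureTheory.volume
      (f' := fun z => fderiv ℝ (fun z => G (z, w₀)) z) (fun z hz => ?_) fun z hz => ?_)
  · exact (hder z hz.1 w₀ (Metric.mem_ball_self hε)).differentiableAt.hasFDerivAt.hasFDerivWithinAt
  · obtain ⟨hz, w, hw, h0⟩ := hz
    rw [(hder z hz w hw).fderiv, det_continuousLinearMap_prod]
    rw [hessDet_eq] at h0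
    exact h0

/-! ### Linear tilts and their convergence -/

/-- The linear form `(x, v, D, c) ↦ a x + b v`. -/
def linXV (s : ℝ × ℝ) : Pt →L[ℝ] ℝ :=
  s.1 • (ContinuousLinearMap.fst ℝ ℝ ℝ).comp (ContinuousLinearMap.fst ℝ (ℝ × ℝ) (ℝ × ℝ)) +
    s.2 • (ContinuousLinearMap.snd ℝ ℝ ℝ).comp (ContinuousLinearMap.fst ℝ (ℝ × ℝ) (ℝ × ℝ))

lemma linXV_apply (s : ℝ × ℝ) (q : Pt) : linXV s q = s.1 * q.1.1 + s.2 * q.1.2 := by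
  simp [linXV]

/-- The family `H - a x - b v`. -/
def Family.tilt {r : ℕ∞} {U : Set Pt} (H : Family r U) (s : ℝ × ℝ) : Family r U where
  ham := H.ham - linXV s
  contDiffOn := H.contDiffOn.sub (linXV s).contDiff.contDiffOn

lemma pd_sub_clm {f : Pt → ℝ} {q : Pt} (hf : DifferentiableAt ℝ f q) (L : Pt →L[ℝ] ℝ) (e : Pt) :
    pd e (f - L) q = pd e f q - L e := by
  rw [pd, fderiv_sub hf L.differentiableAt, L.fderiv]
  rfl

lemma pd_pd_sub_clm {U : Set Pt} (hU : IsOpen U) {f : Pt → ℝ}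
    (hf : ∀ q ∈ U, DifferentiableAt ℝ f q) (L : Pt →L[ℝ] ℝ) (e e' : Pt) {q : Pt} (hq : q ∈ U) :
    pd e (pd e' (f - L)) q = pd e (pd e' f) q := by
  rw [pd_congr hU (fun p hp => pd_sub_clm (hf p hp) L e') e hq]
  change fderiv ℝ (fun p => pd e' f p - L e') q e = _
  rw [fderiv_sub_const]
  rfl

section Tilt

variable {r : ℕ∞} {U : Set Pt} (H : Family r U) (s : ℝ × ℝ)

lemma Family.contDiffOn_of_le (hr : 3 ≤ r) : ContDiffOn ℝ 3 H.ham U :=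
  H.contDiffOn.of_le (WithTop.coe_le_coe.2 hr)

lemma Family.differentiableAt (hr : 3 ≤ r) (hU : IsOpen U) {q : Pt} (hq : q ∈ U) :
    DifferentiableAt ℝ H.ham q :=
  ((H.contDiffOn_of_le hr).contDiffAt (hU.mem_nhds hq)).differentiableAt (by norm_num)

lemma Family.pd_pd_tilt (hr : 3 ≤ r) (hU : IsOpen U) (e e' : Pt) {q : Pt} (hq : q ∈ U) :
    pd e (pd e' (H.tilt s).ham) q = pd e (pd e' H.ham) q :=
  pd_pd_sub_clm hU (fun _ hp => H.differentiableAt hr hU hp) _ e e' hq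

lemma Family.hessDet_tilt (hr : 3 ≤ r) (hU : IsOpen U) {q : Pt} (hq : q ∈ U) :
    hessDet (H.tilt s).ham q = hessDet H.ham q := by
  simp only [hessDet_eq, dX, dV, H.pd_pd_tilt s hr hU _ _ hq]

lemma Family.parabolicSet_tilt (hr : 3 ≤ r) (hU : IsOpen U) {q : Pt}
    (hq : q ∈ parabolicSet U (H.tilt s).ham) :
    (dX H.ham q, dV H.ham q) = s ∧ hessDet H.ham q = 0 := by
  obtain ⟨⟨hqU, hg⟩, hdet⟩ := hq
  rw [gradXV_eq_zero_iff] at hg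
  refine ⟨?_, (H.hessDet_tilt s hr hU hqU).symm.trans hdet⟩
  have h1 : dX H.ham q - linXV s _ = 0 :=
    (pd_sub_clm (H.differentiableAt hr hU hqU) _ _).symm.trans hg.1
  have h2 : dV H.ham q - linXV s _ = 0 :=
    (pd_sub_clm (H.differentiableAt hr hU hqU) _ _).symm.trans hg.2
  rw [linXV_apply] at h1 h2
  exact Prod.ext (by simpa [sub_eq_zero] using h1) (by simpa [sub_eq_zero] using h2)

variable {H}

lemma tilt_mem_uncoupled (hr : 3 ≤ r) (hU : IsOpen U) (hH : H ∈ uncoupled r U) :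
    H.tilt s ∈ uncoupled r U := fun q hq => by
  have := hH q hq
  simpa only [gradXV_eq_zero_iff, dX, dV, dC, dD, H.pd_pd_tilt s hr hU _ _ hq] using this

lemma tilt_mem_separable (hH : H ∈ separable r U) : H.tilt s ∈ separable r U := by
  obtain ⟨h, g, hhg⟩ := hH
  refine ⟨fun z => h z - (s.1 * z.1 + s.2 * z.2), g, fun q hq => ?_⟩
  change H.ham q - linXV s q = _
  rw [hhg q hq, linXV_apply]
  ring

end Tilt

/-- Splitting off the two scalars reduces uniform smallness on compact sets to bounds for two fixed
forms. -/
lemma iteratedFDeriv_sub_linXV {f : Pt → ℝ} {q : Pt} {k : ℕ} (hf : ContDiffAt ℝ k f q)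
    (s : ℝ × ℝ) : iteratedFDeriv ℝ k (f - ⇑(linXV s)) q = iteratedFDeriv ℝ k f q -
      (s.1 • iteratedFDeriv ℝ k (linXV (1, 0)) q + s.2 • iteratedFDeriv ℝ k (linXV (0, 1)) q) := by
  have : (linXV s : Pt → ℝ) = s.1 • (linXV (1, 0) : Pt → ℝ) + s.2 • (linXV (0, 1) : Pt → ℝ) := by
    ext p
    simp [linXV_apply]
  have h1 : ContDiffAt ℝ k (linXV (1, 0)) q := (linXV (1, 0)).contDiff.contDiffAt
  have h2 : ContDiffAt ℝ k (linXV (0, 1)) q := (linXV (0, 1)).contDiff.contDiffAt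
  have h1' : ContDiffAt ℝ k (s.1 • (linXV (1, 0) : Pt → ℝ)) q :=
    (s.1 • linXV (1, 0)).contDiff.contDiffAt
  have h2' : ContDiffAt ℝ k (s.2 • (linXV (0, 1) : Pt → ℝ)) q :=
    (s.2 • linXV (0, 1)).contDiff.contDiffAt
  rw [iteratedFDeriv_sub_apply hf (linXV s).contDiff.contDiffAt, this,
    iteratedFDeriv_add_apply h1' h2',
    iteratedFDeriv_const_smul_apply h1, iteratedFDeriv_const_smul_apply h2]

lemma Family.tendsto_nhds_iff {r : ℕ∞} {U : Set Pt} {ι : Type*} {l : Filter ι}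
    {f : ι → Family r U} {H : Family r U} :
    Tendsto f l (𝓝 H) ↔ ∀ k : ℕ, (k : ℕ∞) ≤ r → ∀ K, IsCompact K → K ⊆ U →
      TendstoUniformlyOn (fun i => iteratedFDeriv ℝ k (f i).ham) (iteratedFDeriv ℝ k H.ham) l K := by
  rw [nhds_induced, tendsto_comap_iff, tendsto_pi_nhds]
  simp only [UniformOnFun.tendsto_iff_tendstoUniformlyOn, Subtype.forall]
  exact forall₂_congr fun k hk => ⟨fun h K hK hKU => h K ⟨hK, hKU⟩, fun h K hK => h K hK.1 hK.2⟩

lemma Family.tendsto_tilt {r : ℕ∞} {U : Set Pt} (hU : IsOpen U) (H : Family r U) :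
    Tendsto H.tilt (𝓝 0) (𝓝 H) := by
  refine Family.tendsto_nhds_iff.2 fun k hk K hK hKU => ?_
  have hcont : ∀ s, Continuous (iteratedFDeriv ℝ k (linXV s)) := fun s =>
    (linXV s).contDiff.continuous_iteratedFDeriv' (m := k)
  obtain ⟨A, hA⟩ := hK.exists_bound_of_continuousOn (hcont (1, 0)).continuousOn
  obtain ⟨B, hB⟩ := hK.exists_bound_of_continuousOn (hcont (0, 1)).continuousOn
  rw [Metric.tendstoUniformlyOn_iff]
  intro ε hε
  have hlim : Tendsto (fun s : ℝ × ℝ => |s.1| * A + |s.2| * B) (𝓝 0) (𝓝 0) := by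
    have : Continuous (fun s : ℝ × ℝ => |s.1| * A + |s.2| * B) := by fun_prop
    simpa using this.tendsto 0
  filter_upwards [hlim.eventually_lt_const hε] with s hs q hq
  have hf : ContDiffAt ℝ k H.ham q :=
    (H.contDiffOn.of_le (by exact_mod_cast hk)).contDiffAt (hU.mem_nhds (hKU hq))
  change dist _ (iteratedFDeriv ℝ k (H.ham - ⇑(linXV s)) q) < ε
  rw [iteratedFDeriv_sub_linXV hf, dist_eq_norm, sub_sub_cancel]
  refine lt_of_le_of_lt (norm_add_le_of_le ?_ ?_) hs
  · rw [norm_smul, Real.norm_eq_abs]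
    exact mul_le_mul_of_nonneg_left (hA q hq) (abs_nonneg _)
  · rw [norm_smul, Real.norm_eq_abs]
    exact mul_le_mul_of_nonneg_left (hB q hq) (abs_nonneg _)

/-! ### Removing parabolic points by small tilts -/

lemma dense_parabolicSet_tilt_inter_eq_empty {r : ℕ∞} {U V : Set Pt} (hr : 3 ≤ r)
    (hU : IsOpen U) (hV : IsOpen V) (hVU : V ⊆ U) (H : Family r U)
    (h : UncoupledOn V H.ham) :
    Dense {s : ℝ × ℝ | parabolicSet U (H.tilt s).ham ∩ V = ∅} := by
  have hf : ContDiffOn ℝ 2 H.ham V :=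
    ((H.contDiffOn_of_le hr).mono hVU).of_le (by norm_num)
  have hae := MeasureTheory.measure_eq_zero_iff_ae_notMem.1 (h.volume_critical_values hV hf)
  refine (MeasureTheory.Measure.dense_of_ae hae).mono fun s hs => ?_
  refine eq_empty_of_forall_notMem fun q hq => hs ?_
  obtain ⟨h1, h2⟩ := H.parabolicSet_tilt s hr hU hq.1
  exact ⟨q, ⟨hq.2, h2⟩, h1⟩

/-- Otherwise arbitrarily small tilts remove all parabolic points from `V`, whatever their frequency
`∂H/∂D`. -/
lemma exists_coupled_of_persistent {r : ℕ∞} {U V : Set Pt} (hr : 3 ≤ r) (hU : IsOpen U)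
    (hV : IsOpen V) (hVU : V ⊆ U) (H : Family r U)
    (hper : {H' : Family r U | (parabolicSet U H'.ham ∩ V).Nonempty} ∈ 𝓝 H) :
    ∃ p ∈ V, Coupled H.ham p := by
  by_contra! hc
  obtain ⟨s, hs, hs'⟩ := (dense_parabolicSet_tilt_inter_eq_empty hr hU hV hVU H fun q hq =>
    (not_coupled_iff _ _).1 (hc q hq)).exists_mem_open isOpen_interior
      ⟨0, mem_interior_iff_mem_nhds.2 (H.tendsto_tilt hU hper)⟩
  exact (interior_subset hs').ne_empty hs

lemma dense_parabolicSet_eq_empty {r : ℕ∞} {U : Set Pt} (hr : 3 ≤ r) (hU : IsOpen U)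
    {𝒞 : Set (Family r U)} (hunc : 𝒞 ⊆ uncoupled r U) (htilt : ∀ H ∈ 𝒞, ∀ s, H.tilt s ∈ 𝒞) :
    Dense {H : 𝒞 | parabolicSet U H.1.ham = ∅} := by
  rintro ⟨H, hH⟩
  rw [mem_closure_iff_nhds]
  intro t ht
  have hlim : Tendsto (fun s => (⟨H.tilt s, htilt H hH s⟩ : 𝒞)) (𝓝 0) (𝓝 ⟨H, hH⟩) :=
    tendsto_subtype_rng.2 (H.tendsto_tilt hU)
  obtain ⟨s, hs, hs'⟩ := (dense_parabolicSet_tilt_inter_eq_empty hr hU hU subset_rfl H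
    (hunc hH)).exists_mem_open isOpen_interior ⟨0, mem_interior_iff_mem_nhds.2 (hlim ht)⟩
  have hsub : parabolicSet U (H.tilt s).ham ⊆ U := fun q hq => hq.1.1
  have hst := interior_subset hs'
  exact ⟨⟨H.tilt s, htilt H hH s⟩, hst, (inter_eq_left.2 hsub).symm.trans hs⟩

/-! ### Openness over compact sets and the `G_δ` property -/

section Open

variable {r : ℕ∞} {U K : Set Pt}

/-- Uniform convergence on `K` combines with continuity of the limit's derivative to give joint
continuity. -/
lemma continuous_iteratedFDeriv_eval (hU : IsOpen U) (hK : IsCompact K) (hKU : K ⊆ U) {k : ℕ}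
    (hk : (k : ℕ∞) ≤ r) :
    Continuous fun p : Family r U × K => iteratedFDeriv ℝ k p.1.ham p.2 := by
  rw [continuous_iff_continuousAt]
  rintro ⟨H, q, hq⟩
  have hf : ContDiffAt ℝ k H.ham q :=
    (H.contDiffOn.of_le (by exact_mod_cast hk)).contDiffAt (hU.mem_nhds (hKU hq))
  have hunif := Family.tendsto_nhds_iff.1
    (tendsto_fst : Tendsto Prod.fst (𝓝 H ×ˢ 𝓝 (⟨q, hq⟩ : K)) (𝓝 H)) k hk K hK hKU
  rw [ContinuousAt, nhds_prod_eq]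
  refine tendsto_comp_of_locally_uniform_limit_within (s := K)
    (f := iteratedFDeriv ℝ k H.ham) (g := fun p : Family r U × K => (p.2 : Pt))
    (F := fun p : Family r U × K => iteratedFDeriv ℝ k p.1.ham)
    (hf.continuousAt_iteratedFDeriv le_rfl).continuousWithinAt ?_
    fun u hu => ⟨K, self_mem_nhdsWithin, hunif u hu⟩
  refine tendsto_nhdsWithin_iff.2 ⟨?_, Eventually.of_forall fun p => p.2.2⟩
  exact (continuous_subtype_val.tendsto _).comp tendsto_snd

lemma continuous_pd_eval (hr : 3 ≤ r) (hU : IsOpen U) (hK : IsCompact K) (hKU : K ⊆ U) (e : Pt) :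
    Continuous fun p : Family r U × K => pd e p.1.ham p.2 := by
  have h : ((1 : ℕ) : ℕ∞) ≤ r := le_trans (by norm_num) hr
  have := (continuous_eval_const (F := ContinuousMultilinearMap ℝ (fun _ : Fin 1 => Pt) ℝ)
    (fun _ => e)).comp (continuous_iteratedFDeriv_eval hU hK hKU h)
  refine this.congr fun p => ?_
  exact iteratedFDeriv_one_apply _

lemma continuous_pd_pd_eval (hr : 3 ≤ r) (hU : IsOpen U) (hK : IsCompact K) (hKU : K ⊆ U)
    (e e' : Pt) : Continuous fun p : Family r U × K => pd e (pd e' p.1.ham) p.2 := by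
  have h : ((2 : ℕ) : ℕ∞) ≤ r := le_trans (by norm_num) hr
  have := (continuous_eval_const (F := ContinuousMultilinearMap ℝ (fun _ : Fin 2 => Pt) ℝ)
    ![e, e']).comp (continuous_iteratedFDeriv_eval hU hK hKU h)
  refine this.congr fun p => ?_
  rw [pd_pd_eq hU ((p.1.contDiffOn_of_le hr).of_le (by norm_num)) e e' (hKU p.2.2)]
  exact iteratedFDeriv_two_apply _ _ _

/-- Pairs of a family and a parabolic point in `K` form a closed set, and projection along the
compact factor `K` is a closed map. -/
lemma isOpen_parabolicSet_inter_eq_empty (hr : 3 ≤ r) (hU : IsOpen U) (hK : IsCompact K)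
    (hKU : K ⊆ U) : IsOpen {H : Family r U | parabolicSet U H.ham ∩ K = ∅} := by
  have : CompactSpace K := isCompact_iff_compactSpace.1 hK
  have h1 := continuous_pd_eval hr hU hK hKU
  have h2 := continuous_pd_pd_eval hr hU hK hKU
  have hcl : IsClosed {p : Family r U × K |
      (dX p.1.ham p.2 = 0 ∧ dV p.1.ham p.2 = 0) ∧ hessDet p.1.ham p.2 = 0} := by
    simp only [hessDet_eq]
    exact ((isClosed_eq (h1 _) continuous_const).inter (isClosed_eq (h1 _) continuous_const)).inter
      (isClosed_eq (((h2 _ _).mul (h2 _ _)).sub ((h2 _ _).mul (h2 _ _))) continuous_const)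
  convert (isClosedMap_fst_of_compactSpace _ hcl).isOpen_compl using 1
  ext H
  simp only [mem_ofPred_eq, mem_compl_iff, eq_empty_iff_forall_notMem]
  constructor
  · rintro h ⟨⟨H', q⟩, hq, rfl⟩
    exact h q ⟨⟨⟨hKU q.2, (gradXV_eq_zero_iff _ _).2 hq.1⟩, hq.2⟩, q.2⟩
  · rintro h q ⟨⟨⟨-, hg⟩, hdet⟩, hqK⟩
    exact h ⟨(H, ⟨q, hqK⟩), ⟨(gradXV_eq_zero_iff _ _).1 hg, hdet⟩, rfl⟩

lemma isGδ_parabolicSet_eq_empty (hr : 3 ≤ r) (hU : IsOpen U) :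
    IsGδ {H : Family r U | parabolicSet U H.ham = ∅} := by
  have : LocallyCompactSpace U := hU.locallyCompactSpace
  obtain ⟨K, hK, hKU⟩ := isSigmaCompact_iff_sigmaCompactSpace.2
    (inferInstance : SigmaCompactSpace U)
  have : {H : Family r U | parabolicSet U H.ham = ∅} =
      ⋂ n, {H : Family r U | parabolicSet U H.ham ∩ K n = ∅} := by
    ext H
    have hsub : parabolicSet U H.ham ⊆ U := fun q hq => hq.1.1
    simp only [mem_ofPred_eq, mem_iInter]
    rw [← iUnion_eq_empty, ← inter_iUnion, hKU, inter_eq_left.2 hsub]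
  rw [this]
  exact .iInter_of_isOpen fun n => isOpen_parabolicSet_inter_eq_empty hr hU (hK n)
    (hKU ▸ subset_iUnion K n)

end Open

lemma separable_subset_uncoupled {r : ℕ∞} {U : Set Pt} (hr : 3 ≤ r) (hU : IsOpen U) :
    separable r U ⊆ uncoupled r U := by
  rintro H ⟨h, g, hhg⟩
  exact uncoupledOn_of_separable hU ((H.contDiffOn_of_le hr).of_le (by norm_num)) hhg

lemma parabolicNongeneric_of_tilt_mem {r : ℕ∞} {U : Set Pt} (hr : 3 ≤ r) (hU : IsOpen U)
    {𝒞 : Set (Family r U)} (hunc : 𝒞 ⊆ uncoupled r U) (htilt : ∀ H ∈ 𝒞, ∀ s, H.tilt s ∈ 𝒞) :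
    ParabolicNongeneric 𝒞 :=
  ⟨(isGδ_parabolicSet_eq_empty hr hU).preimage continuous_subtype_val,
    dense_parabolicSet_eq_empty hr hU hunc htilt⟩

end ParabolicResonance

open ParabolicResonance

theorem lemma5 (r : ℕ∞) (hr : 3 ≤ r) (U : Set Pt) (hU : IsOpen U) :
    -- necessity, generic = transverse
    (∀ H : Family r U, ∀ q : Pt, IsTransverseParabolicCircle U H.ham q →
      q ∈ closure {p | p ∈ U ∧ Coupled H.ham p}) ∧
    -- necessity at the point itself, where the surface of fixed points is cut out transversely
    (∀ H : Family r U, ∀ q ∈ parabolicCircles U H.ham, RegularAt H.ham q → Coupled H.ham q) ∧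
    -- necessity, generic = persistent under small perturbations
    (∀ H : Family r U, ∀ V : Set Pt, IsOpen V → V ⊆ U →
      {H' : Family r U | (parabolicCircles U H'.ham ∩ V).Nonempty} ∈ 𝓝 H →
      ∃ p ∈ V, Coupled H.ham p) ∧
    -- the separable families have vanishing mixed gradients
    separable r U ⊆ uncoupled r U ∧
    -- if both vanish, the surface of fixed points is parallel to the (D, c)-plane
    (∀ H ∈ uncoupled r U, ∀ z : ℝ × ℝ, ∀ C : Set (ℝ × ℝ), IsPreconnected C →
      (∀ w ∈ C, (z, w) ∈ U) → ∀ w ∈ C, ∀ w' ∈ C,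
      (z, w) ∈ fixedSurface U H.ham → (z, w') ∈ fixedSurface U H.ham) ∧
    -- if both vanish, parabolic circles are non-generic
    ParabolicNongeneric (uncoupled r U) ∧ ParabolicNongeneric (separable r U) := by
  have hf : ∀ H : Family r U, ContDiffOn ℝ 2 H.ham U := fun H =>
    (H.contDiffOn_of_le hr).of_le (by norm_num)
  refine ⟨fun H q hq => mem_closure_coupled hU (H.contDiffOn_of_le hr) hq,
    fun H q hq hreg => coupled_of_regularAt hU (hf H) hq.1 hreg,
    fun H V hV hVU hper => exists_coupled_of_persistent hr hU hV hVU H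
      (mem_of_superset hper fun H' h => h.mono (inter_subset_inter_left V inter_subset_left)),
    separable_subset_uncoupled hr hU, fun H hH z C hC hCU w hw w' hw' hwF => ?_,
    parabolicNongeneric_of_tilt_mem hr hU subset_rfl fun H hH s => tilt_mem_uncoupled s hr hU hH,
    parabolicNongeneric_of_tilt_mem hr hU (separable_subset_uncoupled hr hU)
      fun H hH s => tilt_mem_separable s hH⟩
  obtain ⟨h1, h2⟩ := UncoupledOn.gradXV_eq hU hH (hf H) hC hCU hw hw'
  refine ⟨hCU w' hw', ?_⟩
  have := (gradXV_eq_zero_iff _ _).1 hwF.2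
  rw [gradXV_eq_zero_iff, ← h1, ← h2]
  exact this
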